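/- All graphs are finite and simple. A \(k\)-star colouring of a graph \(G\) is a proper vertex colouring of \(G\) with \(k\) colours such that every connected component of the subgraph induced by any two colour classes is a star \(K_{1,q}\) with \(q \ge 0\). Let \(G\) be a 4-regular graph that has no induced subgraph isomorphic to the claw \(K_{1,3}\) and that admits a 4-star colouring. Then \(G\) is isomorphic to the line graph of a bipartite 3-regular graph. In particular, \(G\) is odd-hole-free, i.e., \(G\) has no induced cycle of odd length at least 5. -/

import Mathlib

/-- `G` is `H`-free: no induced subgraph of `G` is isomorphic to `H`. -/
def SimpleGraph.InducedFree {V W : Type*} (G : SimpleGraph V) (H : SimpleGraph W) : Prop :=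
  ¬ H.IsIndContained G

/-- `G` is claw-free, the claw being `K_{1,3}`. -/
def SimpleGraph.ClawFree {V : Type*} (G : SimpleGraph V) : Prop :=
  G.InducedFree (completeBipartiteGraph (Fin 1) (Fin 3))

/-- `G` has no induced odd cycle of length at least `5`. -/
def SimpleGraph.OddHoleFree {V : Type*} (G : SimpleGraph V) : Prop :=
  ∀ q : ℕ, 1 ≤ q → G.InducedFree (SimpleGraph.cycleGraph (2 * q + 3))

/-- `G` is a star `K_{1,q}` for some `q ≥ 0`. -/
def SimpleGraph.IsStar {V : Type*} (G : SimpleGraph V) : Prop :=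
  ∃ q : ℕ, Nonempty (G ≃g completeBipartiteGraph (Fin 1) (Fin q))

/-- A (proper) `k`-colouring is a `k`-star colouring if every connected component of the subgraph
induced by two colour classes is a star. -/
def SimpleGraph.IsStarColoring {V : Type*} {G : SimpleGraph V} {k : ℕ}
    (f : G.Coloring (Fin k)) : Prop :=
  ∀ i j : Fin k, i ≠ j →
    ∀ c : (G.induce (f ⁻¹' {i} ∪ f ⁻¹' {j})).ConnectedComponent, c.toSimpleGraph.IsStar

/-- `G` admits a `k`-star colouring. -/
def SimpleGraph.StarColorable {V : Type*} (G : SimpleGraph V) (k : ℕ) : Prop :=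
  ∃ f : G.Coloring (Fin k), SimpleGraph.IsStarColoring f

open Finset

namespace SimpleGraph

variable {V : Type*} {G : SimpleGraph V}

/-! ### Star colourings and bicoloured paths -/

/-! A neighbour of `v` is unique if no other neighbour of `v` has its colour. With no bicoloured
path on four vertices, each edge is unique from at least one end (`uniqueNbr_or`), while a vertex
has at most two unique neighbours; in a 4-regular graph double counting makes both bounds sharp
(`uniqueNbrs_tight`). So `v` sees one colour `g v` twice and the other two once. Direct an edge from
`v` to `u` when `f u = g v`.

Claw-freeness then groups the edges at `v` into two directed triangles, and the parity of the cyclic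
order of colours tells them apart (`exists_triangle_labelling`). The triangles of each label
partition the vertices. With triangles as vertices, and each vertex of `G` as an edge joining its
two triangles, they form the bipartite cubic graph whose line graph is `G`. Along a hole the labels
alternate, so its length is even. -/

/-- In a star, two edges always share an endpoint. -/
theorem IsStar.not_disjoint_edges (hG : G.IsStar) {u v w x : V} (huv : G.Adj u v)
    (hwx : G.Adj w x) : u = w ∨ u = x ∨ v = w ∨ v = x := by
  obtain ⟨q, ⟨e⟩⟩ := hG
  have h1 := e.map_adj_iff.2 huv
  have h2 := e.map_adj_iff.2 hwx
  simp only [← e.injective.eq_iff]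
  generalize e u = u' at *
  generalize e v = v' at *
  generalize e w = w' at *
  generalize e x = x' at *
  rcases u' with u' | u' <;> rcases v' with v' | v' <;> rcases w' with w' | w' <;>
    rcases x' with x' | x' <;> simp [completeBipartiteGraph] at h1 h2 ⊢ <;>
    first
      | exact Subsingleton.elim (α := Fin 1) _ _
      | exact Or.inl (Subsingleton.elim (α := Fin 1) _ _)
      | exact Or.inr (Subsingleton.elim (α := Fin 1) _ _)

/-- A star colouring has no bicoloured path on four vertices. -/
theorem IsStarColoring.no_bicoloured_path {k : ℕ} {f : G.Coloring (Fin k)}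
    (hf : IsStarColoring f) {u v w x : V} (huv : G.Adj u v) (hvw : G.Adj v w) (hwx : G.Adj w x)
    (huw : u ≠ w) (hvx : v ≠ x) (h1 : f u = f w) (h2 : f v = f x) : False := by
  have hne : f u ≠ f v := f.valid huv
  let S : Set V := f ⁻¹' {f u} ∪ f ⁻¹' {f v}
  have hu : u ∈ S := by simp [S]
  have hv : v ∈ S := by simp [S]
  have hw : w ∈ S := by simp [S, h1]
  have hx : x ∈ S := by simp [S, h2]
  have auv : (G.induce S).Adj ⟨u, hu⟩ ⟨v, hv⟩ := huv
  have avw : (G.induce S).Adj ⟨v, hv⟩ ⟨w, hw⟩ := hvw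
  have awx : (G.induce S).Adj ⟨w, hw⟩ ⟨x, hx⟩ := hwx
  let c := (G.induce S).connectedComponentMk ⟨u, hu⟩
  have cu : (⟨u, hu⟩ : S) ∈ c := rfl
  have cv : (⟨v, hv⟩ : S) ∈ c := c.mem_supp_of_adj_mem_supp cu auv
  have cw : (⟨w, hw⟩ : S) ∈ c := c.mem_supp_of_adj_mem_supp cv avw
  have cx : (⟨x, hx⟩ : S) ∈ c := c.mem_supp_of_adj_mem_supp cw awx
  have key := (hf _ _ hne c).not_disjoint_edges
    ((c.toSimpleGraph_adj cu cv).2 auv) ((c.toSimpleGraph_adj cw cx).2 awx)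
  simp only [Subtype.mk.injEq] at key
  rcases key with h | h | h | h
  · exact huw h
  · exact hne (by rw [h2, h])
  · exact hvw.ne h
  · exact hvx h

/-! ### Neighbours of a unique colour -/

/-- `u` is a neighbour of `v`, and the only one of its colour. -/
def UniqueNbr {k : ℕ} (f : G.Coloring (Fin k)) (v u : V) : Prop :=
  G.Adj v u ∧ ∀ w, G.Adj v w → f w = f u → w = u

/-- If both failed, a second neighbour `x` of `u` coloured like `v` and a second neighbour `y` of
`v` coloured like `u` would give the bicoloured path `x, u, v, y`. -/
theorem IsStarColoring.uniqueNbr_or {k : ℕ} {f : G.Coloring (Fin k)}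
    (hf : IsStarColoring f) {u v : V} (huv : G.Adj u v) : UniqueNbr f u v ∨ UniqueNbr f v u := by
  by_contra! h
  simp only [UniqueNbr, huv, huv.symm, true_and] at h
  push Not at h
  obtain ⟨⟨x, ux, hx, hxv⟩, ⟨y, vy, hy, hyu⟩⟩ := h
  exact hf.no_bicoloured_path ux.symm huv vy hxv (Ne.symm hyu) hx hy.symm

section Counting

variable [Fintype V]

open Classical in
/-- The set of neighbours of `v` that are the only ones of their colour. -/
noncomputable def uniqueNbrs {k : ℕ} (f : G.Coloring (Fin k)) (v : V) : Finset V :=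
  univ.filter (UniqueNbr f v)

theorem mem_uniqueNbrs {k : ℕ} {f : G.Coloring (Fin k)} {u v : V} :
    u ∈ uniqueNbrs f v ↔ UniqueNbr f v u := by
  simp [uniqueNbrs]

theorem injOn_uniqueNbrs {k : ℕ} (f : G.Coloring (Fin k)) (v : V) :
    Set.InjOn f (uniqueNbrs f v) := fun a ha _ hb hab =>
  (mem_uniqueNbrs.1 hb).2 a (mem_uniqueNbrs.1 ha).1 hab

open Classical in
theorem card_free_colours (f : G.Coloring (Fin 4)) (v : V) :
    (({f v}ᶜ : Finset (Fin 4)) \ (uniqueNbrs f v).image f).card + (uniqueNbrs f v).card = 3 := by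
  have hsub : (uniqueNbrs f v).image f ⊆ ({f v}ᶜ : Finset (Fin 4)) := by
    intro c hc
    obtain ⟨u, hu, rfl⟩ := mem_image.1 hc
    simpa using (f.valid (mem_uniqueNbrs.1 hu).1).symm
  have := card_sdiff_add_card_eq_card hsub
  rw [card_image_of_injOn (injOn_uniqueNbrs f v)] at this
  simpa [card_compl] using this

variable [G.LocallyFinite]

theorem uniqueNbrs_subset {k : ℕ} (f : G.Coloring (Fin k)) (v : V) :
    uniqueNbrs f v ⊆ G.neighborFinset v := fun u hu => by
  simpa using (mem_uniqueNbrs.1 hu).1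

open Classical in
theorem colour_mem_free {f : G.Coloring (Fin 4)} {u v : V}
    (hu : u ∈ G.neighborFinset v \ uniqueNbrs f v) :
    f u ∈ ({f v}ᶜ : Finset (Fin 4)) \ (uniqueNbrs f v).image f := by
  simp only [mem_sdiff, mem_neighborFinset, mem_compl, mem_singleton, mem_image, not_exists,
    not_and] at hu ⊢
  refine ⟨(f.valid hu.1).symm, fun x hx hxu => hu.2 ?_⟩
  rwa [(mem_uniqueNbrs.1 hx).2 u hu.1 hxu.symm]

/-- Three unique neighbours would use up every colour except `f v`, leaving none for the fourth
neighbour. -/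
theorem card_uniqueNbrs_le (hreg : G.IsRegularOfDegree 4) (f : G.Coloring (Fin 4)) (v : V) :
    (uniqueNbrs f v).card ≤ 2 := by
  classical
  have h1 := card_free_colours f v
  have h2 : (G.neighborFinset v \ uniqueNbrs f v).card + (uniqueNbrs f v).card = 4 :=
    (card_sdiff_add_card_eq_card (uniqueNbrs_subset f v)).trans (hreg v)
  by_contra hlt
  have h3 : 0 < (G.neighborFinset v \ uniqueNbrs f v).card := by omega
  obtain ⟨u, hu⟩ := card_pos.1 h3
  have h4 := card_pos.2 ⟨_, colour_mem_free hu⟩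
  omega

/-- In a 4-regular graph with a 4-star colouring, every vertex has exactly two unique neighbours,
and every edge is a unique neighbour from exactly one of its ends. -/
theorem IsStarColoring.uniqueNbrs_tight (hreg : G.IsRegularOfDegree 4) {f : G.Coloring (Fin 4)}
    (hf : IsStarColoring f) (v : V) :
    (uniqueNbrs f v).card = 2 ∧ ∀ u, UniqueNbr f v u → ¬ UniqueNbr f u v := by
  classical
  let In : V → Finset V := fun v => univ.filter fun u => UniqueNbr f u v
  have hIn : ∑ v, (In v).card = ∑ v, (uniqueNbrs f v).card := by
    simp only [In, uniqueNbrs, card_filter]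
    rw [sum_comm]
  have hunion : ∀ v, uniqueNbrs f v ∪ In v = G.neighborFinset v := by
    intro v
    ext u
    simp only [mem_union, mem_uniqueNbrs, In, mem_filter, mem_univ, true_and, mem_neighborFinset]
    exact ⟨fun h => h.elim (fun h => h.1) (fun h => h.1.symm), fun h => hf.uniqueNbr_or h⟩
  have hge : ∀ v, (uniqueNbrs f v).card + (In v).card
      = 4 + (uniqueNbrs f v ∩ In v).card := by
    intro v
    rw [← card_union_add_card_inter, hunion, card_neighborFinset_eq_degree, hreg v]
  have hle := card_uniqueNbrs_le hreg f
  -- The total deficit from 2 and the total overlap vanish together. The truncated subtraction is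
  -- harmless by `hle`.
  have hzero : ∑ v, (2 * (2 - (uniqueNbrs f v).card) + (uniqueNbrs f v ∩ In v).card) = 0 := by
    have e1 : ∑ v, (4 + (uniqueNbrs f v ∩ In v).card) = 2 * ∑ v, (uniqueNbrs f v).card := by
      rw [← sum_congr rfl fun v _ => hge v, sum_add_distrib, hIn]; ring
    have e2 : ∑ v, (2 - (uniqueNbrs f v).card) + ∑ v, (uniqueNbrs f v).card = ∑ _v : V, 2 := by
      rw [← sum_add_distrib]
      exact sum_congr rfl fun v _ => by have := hle v; omega
    rw [sum_add_distrib, ← mul_sum]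
    simp only [sum_add_distrib, sum_const, smul_eq_mul] at e1 e2
    omega
  have hv := (sum_eq_zero_iff.1 hzero) v (mem_univ v)
  have := hle v
  refine ⟨by omega, fun u h1 h2 => ?_⟩
  have : uniqueNbrs f v ∩ In v = ∅ := card_eq_zero.1 (by omega)
  have hu : u ∈ uniqueNbrs f v ∩ In v := by simp [mem_uniqueNbrs, In, h1, h2]
  simp [this] at hu

/-- The neighbourhoods in a 4-regular graph with a 4-star colouring: the four neighbours of `v`
have colours `g v`, `g v` and the two colours other than `f v` and `g v`; for each edge exactly
one end `v` has the other end in colour `g v`. -/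
theorem IsStarColoring.exists_double_colour (hreg : G.IsRegularOfDegree 4)
    {f : G.Coloring (Fin 4)} (hf : IsStarColoring f) :
    ∃ g : V → Fin 4,
      (∀ v, ∃ a b c d, a ≠ b ∧ (∀ u, G.Adj v u ↔ u = a ∨ u = b ∨ u = c ∨ u = d) ∧
        f a = g v ∧ f b = g v ∧ f c ≠ g v ∧ f d ≠ g v ∧ f c ≠ f d) ∧
      ∀ u v, G.Adj u v → (f u = g v ↔ f v ≠ g u) := by
  classical
  have hloc : ∀ v, ∃ a b c d, a ≠ b ∧ (∀ u, G.Adj v u ↔ u = a ∨ u = b ∨ u = c ∨ u = d) ∧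
      f b = f a ∧ f c ≠ f a ∧ f d ≠ f a ∧ f c ≠ f d ∧ UniqueNbr f v c ∧ UniqueNbr f v d := by
    intro v
    have h1 := card_free_colours f v
    have h2 : (G.neighborFinset v \ uniqueNbrs f v).card + (uniqueNbrs f v).card = 4 :=
      (card_sdiff_add_card_eq_card (uniqueNbrs_subset f v)).trans (hreg v)
    have h3 := (hf.uniqueNbrs_tight hreg v).1
    obtain ⟨a, b, hab, hR⟩ := card_eq_two.1 (by omega :
      (G.neighborFinset v \ uniqueNbrs f v).card = 2)
    obtain ⟨c, d, hcd, hU⟩ := card_eq_two.1 h3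
    -- Only one colour is left for the two non-unique neighbours, so they share it.
    obtain ⟨x, hx⟩ := card_eq_one.1 (by omega :
      (({f v}ᶜ : Finset (Fin 4)) \ (uniqueNbrs f v).image f).card = 1)
    have ha := colour_mem_free (f := f) (v := v) (u := a) (by rw [hR]; simp)
    have hb := colour_mem_free (f := f) (v := v) (u := b) (by rw [hR]; simp)
    have hc : c ∈ uniqueNbrs f v := by rw [hU]; simp
    have hd : d ∈ uniqueNbrs f v := by rw [hU]; simp
    have hne : ∀ e ∈ uniqueNbrs f v, f e ≠ f a := fun e he h =>
      (mem_sdiff.1 ha).2 (mem_image.2 ⟨e, he, h⟩)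
    refine ⟨a, b, c, d, hab, fun u => ?_, ?_, hne c hc, hne d hd,
      fun h => hcd (injOn_uniqueNbrs f v hc hd h), mem_uniqueNbrs.1 hc, mem_uniqueNbrs.1 hd⟩
    · rw [← mem_neighborFinset, ← sdiff_union_of_subset (uniqueNbrs_subset f v), hR, hU]
      simp only [mem_union, mem_insert, mem_singleton, or_assoc]
    · rw [hx, mem_singleton] at ha hb
      rw [ha, hb]
  choose a b c d hab hN hfb hca hda hcd hc hd using hloc
  have hiff : ∀ u v, G.Adj v u → (f u = f (a v) ↔ ¬ UniqueNbr f v u) := by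
    intro u v h
    constructor
    · intro hu hU
      exact hab v ((hU.2 _ ((hN v _).2 (by simp)) hu.symm).trans
        (hU.2 _ ((hN v _).2 (by simp)) ((hfb v).trans hu.symm)).symm)
    · intro hU
      rcases (hN v u).1 h with rfl | rfl | rfl | rfl
      exacts [rfl, hfb v, (hU (hc v)).elim, (hU (hd v)).elim]
  refine ⟨fun v => f (a v), fun v => ⟨a v, b v, c v, d v, hab v, hN v, rfl, hfb v, hca v, hda v,
    hcd v⟩, fun u v h => ?_⟩
  rw [hiff u v h.symm, Ne, hiff v u h, not_not]
  exact ⟨fun h' => (hf.uniqueNbr_or h).resolve_right h',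
    fun h' => (hf.uniqueNbrs_tight hreg u).2 v h'⟩

end Counting

/-! ### Claw-freeness and the parity labelling -/

theorem ClawFree.adj_of_three (hG : G.ClawFree) {v x y z : V} (hx : G.Adj v x) (hy : G.Adj v y)
    (hz : G.Adj v z) (hxy : x ≠ y) (hxz : x ≠ z) (hyz : y ≠ z) :
    G.Adj x y ∨ G.Adj x z ∨ G.Adj y z := by
  by_contra! h
  obtain ⟨h1, h2, h3⟩ := h
  apply hG
  refine ⟨⟨⟨Sum.elim (fun _ => v) ![x, y, z], ?_⟩, ?_⟩⟩
  · rintro (i | i) (j | j) hij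
    · rw [Subsingleton.elim i j]
    · fin_cases j <;> simp_all
    · fin_cases i <;> simp_all
    · fin_cases i <;> fin_cases j <;> simp_all
  · intro i j
    change G.Adj (Sum.elim (fun _ => v) ![x, y, z] i) (Sum.elim (fun _ => v) ![x, y, z] j) ↔ _
    rcases i with i | i <;> rcases j with j | j
    · simp
    · fin_cases j <;> simp_all
    · fin_cases i <;> simp_all [adj_comm]
    · fin_cases i <;> fin_cases j <;> simp_all [adj_comm]

/-- The parity of the permutation `a, b, c, d` of `Fin 4`, where `d` is the missing element. -/
def triplePar (a b c : Fin 4) : Bool :=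
  xor (xor (decide (a < b)) (xor (decide (b < c)) (decide (a < c))))
    -- As `a + b + c = 6 - d`, this is the parity of the `3 - d` inversions involving the last entry
    -- `d`.
    (decide ((a.val + b.val + c.val) % 2 = 0))

/-- A 3-cycle is even, so a label depends only on the cyclic order of colours around a triangle. -/
theorem triplePar_rotate : ∀ a b c : Fin 4, a ≠ b → b ≠ c → a ≠ c →
    triplePar b c a = triplePar a b c := by
  decide

/-- Exchanging `b` with the missing element `d` is a transposition. -/
theorem triplePar_replace : ∀ a b c d : Fin 4, [a, b, c, d].Nodup →
    triplePar a d c = !triplePar a b c := by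
  decide

/-- The parity label of an edge, for vertex labellings `f` and `g`. -/
def edgePar (f g : V → Fin 4) (u v : V) : Bool :=
  if g v = f u then triplePar (f u) (f v) (g u) else triplePar (f v) (f u) (g v)

/-- In a claw-free 4-regular 4-star-coloured graph, edges can be labelled by `Bool` so that each
vertex lies in exactly one triangle of each label, and these contain all its edges. -/
theorem exists_triangle_labelling [Fintype V] [G.LocallyFinite] (hreg : G.IsRegularOfDegree 4)
    (hclaw : G.ClawFree) (hstar : G.StarColorable 4) :
    ∃ s : V → V → Bool, (∀ u v, G.Adj u v → s u v = s v u) ∧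
      ∀ v i, ∃ c a, G.Adj v c ∧ G.Adj v a ∧ G.Adj c a ∧ s v c = i ∧ s v a = i ∧ s c a = i ∧
        ∀ u, G.Adj v u → s v u = i → u = c ∨ u = a := by
  obtain ⟨f, hf⟩ := hstar
  obtain ⟨g, hN, hxor⟩ := hf.exists_double_colour hreg
  have hval : ∀ {u v}, G.Adj u v → f u ≠ f v := fun h => f.valid h
  have hs : ∀ u v, G.Adj u v → edgePar f g u v = edgePar f g v u := by
    intro u v h
    have := hxor u v h
    unfold edgePar
    grind
  refine ⟨edgePar f g, hs, fun v => ?_⟩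
  obtain ⟨a, b, c, d, hab, hNv, ha, hb, hc, hd, hcd⟩ := hN v
  have va : G.Adj v a := (hNv a).2 (by simp)
  have vb : G.Adj v b := (hNv b).2 (by simp)
  have vc : G.Adj v c := (hNv c).2 (by simp)
  have vd : G.Adj v d := (hNv d).2 (by simp)
  have gc : g c = f v := by have := hxor v c vc; grind
  have gd : g d = f v := by have := hxor v d vd; grind
  have nab : ¬ G.Adj a b := fun h => hval h (ha.trans hb.symm)
  -- an edge between the two kinds of neighbours determines the double colour
  have key : ∀ x y, G.Adj v x → G.Adj x y → f x = g v → g y = f v → g x = f y := by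
    intro x y hvx hxy hx hy
    have := hxor x y hxy
    have := hval hvx
    grind
  -- `a` and `b` have the same colour, so only an edge to `c` can prevent a claw at `v`.
  have hac : G.Adj a c ∨ G.Adj b c := by
    have := hclaw.adj_of_three va vb vc hab (by grind) (by grind)
    tauto
  have had : G.Adj a d ∨ G.Adj b d := by
    have := hclaw.adj_of_three va vb vd hab (by grind) (by grind)
    tauto
  -- a triangle `v, y, x` with `x` of the double colour carries a single label
  have tri : ∀ x y, G.Adj v x → G.Adj v y → G.Adj x y → f x = g v → g y = f v →
      f y ≠ g v →
      edgePar f g v y = triplePar (f v) (f y) (g v) ∧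
      edgePar f g v x = triplePar (f v) (f y) (g v) ∧
      edgePar f g y x = triplePar (f v) (f y) (g v) := by
    intro x y vx vy xy hx hy hyv
    have gx := key x y vx xy hx hy
    have h1 := hval vx
    have h2 := hval vy
    have r1 := triplePar_rotate (f v) (f y) (g v) h2 hyv (hx ▸ h1)
    have r2 := triplePar_rotate (f y) (g v) (f v) hyv (hx ▸ h1.symm) h2.symm
    refine ⟨?_, ?_, ?_⟩
    · simp [edgePar, hy]
    · rw [edgePar, if_neg (by rw [gx]; exact h2.symm), hx, gx, r2, r1]
    · rw [edgePar, if_pos gx, hx, hy, r1]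
  -- the two triangles at `v` have different labels
  have main : ∀ x y, (∀ u, G.Adj v u ↔ u = x ∨ u = y ∨ u = c ∨ u = d) →
      f x = g v → f y = g v → G.Adj x c → G.Adj y d →
      ∀ i, ∃ c a, G.Adj v c ∧ G.Adj v a ∧ G.Adj c a ∧ edgePar f g v c = i ∧
        edgePar f g v a = i ∧ edgePar f g c a = i ∧
        ∀ u, G.Adj v u → edgePar f g v u = i → u = c ∨ u = a := by
    intro x y hNv' hx hy xc yd i
    have vx : G.Adj v x := (hNv' x).2 (by simp)
    have vy : G.Adj v y := (hNv' y).2 (by simp)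
    obtain ⟨c1, c2, c3⟩ := tri x c vx vc xc hx gc hc
    obtain ⟨d1, d2, d3⟩ := tri y d vy vd yd hy gd hd
    have hrep := triplePar_replace (f v) (f c) (g v) (f d) (by
      have := hval vx
      have := hval vc
      have := hval vd
      simp only [List.nodup_cons, List.mem_cons, List.not_mem_nil, List.nodup_nil]
      grind)
    by_cases hi : triplePar (f v) (f c) (g v) = i
    · refine ⟨c, x, vc, vx, xc.symm, c1.trans hi, c2.trans hi, c3.trans hi, fun u hu hui => ?_⟩
      rcases (hNv' u).1 hu with rfl | rfl | rfl | rfl <;> simp_all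
    · have hi' : triplePar (f v) (f d) (g v) = i := by
        rw [hrep]; cases i <;> simp_all
      refine ⟨d, y, vd, vy, yd.symm, d1.trans hi', d2.trans hi', d3.trans hi', fun u hu hui => ?_⟩
      rcases (hNv' u).1 hu with rfl | rfl | rfl | rfl <;> simp_all
  rcases hac with h1 | h1 <;> rcases had with h2 | h2
  -- If `a` were joined to both `c` and `d`, then `g a` would equal both of their distinct colours.
  · exact absurd ((key a c va h1 ha gc).symm.trans (key a d va h2 ha gd)) hcd
  · exact main a b hNv ha hb h1 h2
  · exact main b a (fun u => by rw [hNv u]; tauto) hb ha h1 h2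
  · exact absurd ((key b c vb h1 hb gc).symm.trans (key b d vb h2 hb gd)) hcd

/-! ### Line graphs from two partitions into triangles -/

/-- Two partitions of the vertex set into triangles (with blocks `P b v`, told apart by `κ`) that
together account for all edges. -/
structure IsTrianglePartition {W : Type*} (G : SimpleGraph V) (P : Bool → V → W) (κ : W → Bool) :
    Prop where
  side : ∀ b v, κ (P b v) = b
  surj : ∀ x, ∃ v, P (κ x) v = x
  inj : ∀ u v, (∀ b, P b u = P b v) → u = v
  adj : ∀ u v, G.Adj u v ↔ u ≠ v ∧ ∃ b, P b u = P b v
  block : ∀ b v, ∃ c a, v ≠ c ∧ v ≠ a ∧ c ≠ a ∧ ∀ u, P b u = P b v ↔ u = v ∨ u = c ∨ u = a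

/-- Being equal or joined by an edge of label `b` is transitive, since the edges of label `b` at a
vertex lie in one triangle; the blocks are its classes. -/
theorem exists_isTrianglePartition [Fintype V] [G.LocallyFinite] (hreg : G.IsRegularOfDegree 4)
    (hclaw : G.ClawFree) (hstar : G.StarColorable 4) :
    ∃ (n : ℕ) (P : Bool → V → Fin n) (κ : Fin n → Bool), G.IsTrianglePartition P κ := by
  classical
  obtain ⟨s, hsymm, hT⟩ := exists_triangle_labelling hreg hclaw hstar
  let r : Bool → Setoid V := fun b =>
    { r := fun u v => u = v ∨ (G.Adj u v ∧ s u v = b)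
      iseqv := by
        refine ⟨fun _ => Or.inl rfl, ?_, ?_⟩
        · rintro u v (h | ⟨h, h'⟩)
          · exact Or.inl h.symm
          · exact Or.inr ⟨h.symm, by rw [← hsymm u v h, h']⟩
        · rintro u v w (rfl | ⟨h, h'⟩) (rfl | ⟨k, k'⟩)
          · exact Or.inl rfl
          · exact Or.inr ⟨k, k'⟩
          · exact Or.inr ⟨h, h'⟩
          · obtain ⟨c, a, -, -, hca, -, -, sca, hall⟩ := hT v b
            have hac := hsymm c a hca
            have h1 := hall u h.symm (by rw [hsymm v u h.symm, h'])
            have h2 := hall w k k'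
            rcases h1 with rfl | rfl <;> rcases h2 with rfl | rfl
            · exact Or.inl rfl
            · exact Or.inr ⟨hca, sca⟩
            · exact Or.inr ⟨hca.symm, by rw [← hac, sca]⟩
            · exact Or.inl rfl }
  let e := Fintype.equivFin (Σ b, Quotient (r b))
  let P : Bool → V → Fin (Fintype.card (Σ b, Quotient (r b))) := fun b v =>
    e ⟨b, Quotient.mk (r b) v⟩
  have hP : ∀ b u v, P b u = P b v ↔ u = v ∨ (G.Adj u v ∧ s u v = b) := by
    intro b u v
    simp only [P, e.injective.eq_iff, Sigma.mk.injEq, heq_eq_eq, true_and]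
    exact Quotient.eq (r := r b)
  refine ⟨_, P, fun x => (e.symm x).1, ?_, ?_, ?_, ?_, ?_⟩
  · intro b v
    simp [P]
  · intro x
    obtain ⟨⟨b, y⟩, rfl⟩ := e.surjective x
    obtain ⟨v, rfl⟩ := Quotient.exists_rep y
    refine ⟨v, ?_⟩
    simp only [Equiv.symm_apply_apply, P]
  · intro u v h
    have h1 := (hP _ _ _).1 (h true)
    have h2 := (hP _ _ _).1 (h false)
    grind
  · intro u v
    simp only [hP]
    constructor
    · exact fun h => ⟨h.ne, _, Or.inr ⟨h, rfl⟩⟩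
    · rintro ⟨hne, b, h | h⟩
      exacts [absurd h hne, h.1]
  · intro b v
    obtain ⟨c, a, vc, va, ca, svc, sva, sca, hall⟩ := hT v b
    refine ⟨c, a, vc.ne, va.ne, ca.ne, fun u => ?_⟩
    rw [hP]
    constructor
    · rintro (h | ⟨h, h'⟩)
      · exact Or.inl h
      · exact Or.inr (hall u h.symm (by rw [hsymm v u h.symm, h']))
    · rintro (h | rfl | rfl)
      · exact Or.inl h
      · exact Or.inr ⟨vc.symm, by rw [← hsymm v u vc, svc]⟩
      · exact Or.inr ⟨va.symm, by rw [← hsymm v u va, sva]⟩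

namespace IsTrianglePartition

variable {W : Type*} {P : Bool → V → W} {κ : W → Bool}

/-- The graph on the blocks, with one edge for each vertex of `G`. -/
def blockGraph (P : Bool → V → W) (κ : W → Bool) (hκ : ∀ b v, κ (P b v) = b) :
    SimpleGraph W where
  Adj x y := ∃ b v, x = P b v ∧ y = P (!b) v
  symm := ⟨by
    rintro _ _ ⟨b, v, rfl, rfl⟩
    exact ⟨!b, v, rfl, by simp⟩⟩
  loopless := ⟨by
    rintro _ ⟨b, v, h, h'⟩
    have := congrArg κ (h.symm.trans h')
    simp [hκ] at this⟩

theorem isBipartite (h : G.IsTrianglePartition P κ) : (blockGraph P κ h.side).IsBipartite := by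
  have C : (blockGraph P κ h.side).Coloring Bool := Coloring.mk κ <| by
    rintro _ _ ⟨b, v, rfl, rfl⟩
    simp [h.side]
  exact C.colorable

theorem isRegularOfDegree (h : G.IsTrianglePartition P κ)
    [(blockGraph P κ h.side).LocallyFinite] :
    (blockGraph P κ h.side).IsRegularOfDegree 3 := by
  classical
  intro x
  obtain ⟨v, hv⟩ := h.surj x
  obtain ⟨c, a, hvc, hva, hca, hall⟩ := h.block (κ x) v
  rw [hv] at hall
  have hN : (blockGraph P κ h.side).neighborFinset x
      = ({v, c, a} : Finset V).image (P (!κ x)) := by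
    ext y
    simp only [mem_neighborFinset, mem_image, mem_insert, mem_singleton, ← hall]
    constructor
    · rintro ⟨b, u, hx, rfl⟩
      have hb : κ x = b := by rw [hx, h.side]
      exact ⟨u, by rw [hb, ← hx], by rw [hb]⟩
    · rintro ⟨u, hu, rfl⟩
      exact ⟨κ x, u, hu.symm, rfl⟩
  rw [← card_neighborFinset_eq_degree, hN, card_image_of_injOn]
  · exact card_eq_three.2 ⟨v, c, a, hvc, hva, hca, rfl⟩
  · intro y hy z hz hyz
    simp only [coe_insert, coe_singleton, Set.mem_insert_iff, Set.mem_singleton_iff, ← hall]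
      at hy hz
    -- Two vertices of block `x` with the same opposite block would share both blocks.
    refine h.inj y z fun b => ?_
    rcases Bool.eq_or_eq_not b (κ x) with rfl | rfl
    · rw [hy, hz]
    · exact hyz

theorem nonempty_iso_lineGraph (h : G.IsTrianglePartition P κ) :
    Nonempty (G ≃g (blockGraph P κ h.side).lineGraph) := by
  have hne : ∀ u v, P true u ≠ P false v := fun u v huv => by
    have := congrArg κ huv
    simp [h.side] at this
  let φ : V → (blockGraph P κ h.side).edgeSet := fun v =>
    ⟨s(P true v, P false v), ⟨true, v, rfl, rfl⟩⟩
  have hφ : Function.Bijective φ := by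
    constructor
    · intro u v huv
      have := congrArg Subtype.val huv
      simp only [φ, Sym2.eq_iff] at this
      rcases this with ⟨h1, h2⟩ | ⟨h1, -⟩
      · exact h.inj u v fun b => by cases b <;> assumption
      · exact absurd h1 (hne u v)
    · rintro ⟨⟨x, y⟩, he⟩
      obtain ⟨b, v, hx, hy⟩ : (blockGraph P κ h.side).Adj x y := he
      refine ⟨v, Subtype.ext ?_⟩
      change s(P true v, P false v) = s(x, y)
      rw [hx, hy]
      cases b
      · exact Sym2.eq_swap
      · rfl
  refine ⟨⟨Equiv.ofBijective φ hφ, ?_⟩⟩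
  intro u v
  rw [h.adj]
  change (φ u ≠ φ v ∧ _) ↔ _
  rw [hφ.1.ne_iff]
  refine and_congr_right fun _ => ?_
  constructor
  · rintro ⟨x, hx, hx'⟩
    simp only [Equiv.ofBijective_apply, φ, SetLike.mem_coe, Sym2.mem_iff] at hx hx'
    rcases hx with rfl | rfl <;> rcases hx' with hx' | hx'
    · exact ⟨true, hx'⟩
    · exact absurd hx' (hne u v)
    · exact absurd hx'.symm (hne v u)
    · exact ⟨false, hx'⟩
  · rintro ⟨b, hb⟩
    refine ⟨P b u, ?_⟩
    cases b <;> simp [φ, hb]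

open Fin.CommRing in
-- Consecutive edges of a hole in the same block would create a chord, so `β` alternates around the
-- cycle.
theorem oddHoleFree (h : G.IsTrianglePartition P κ) : G.OddHoleFree := by
  rintro q hq ⟨w⟩
  have hadj : ∀ i j, G.Adj (w i) (w j) ↔ i - j = 1 ∨ j - i = 1 := fun i j =>
    w.map_adj_iff.trans cycleGraph_adj
  -- Here `1 ≤ q` matters: a triangle may lie in a single block.
  have h3 : (3 : Fin (2 * q + 3)) ≠ 0 := fun h => by
    have := congrArg Fin.val h
    change 3 % (2 * q + 3) = 0 % (2 * q + 3) at this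
    rw [Nat.mod_eq_of_lt (by omega), Nat.zero_mod] at this
    omega
  have h2 : (2 : Fin (2 * q + 3)) ≠ 0 := fun h => by
    have := congrArg Fin.val h
    change 2 % (2 * q + 3) = 0 % (2 * q + 3) at this
    rw [Nat.mod_eq_of_lt (by omega), Nat.zero_mod] at this
    omega
  have h1 : (1 : Fin (2 * q + 3)) ≠ 0 := fun h => by
    have := congrArg Fin.val h
    change 1 % (2 * q + 3) = 0 % (2 * q + 3) at this
    rw [Nat.mod_eq_of_lt (by omega), Nat.zero_mod] at this
    omega
  have hstep : ∀ i, ∃ b, P b (w i) = P b (w (i + 1)) := fun i =>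
    ((h.adj _ _).1 ((hadj i (i + 1)).2 (Or.inr (by ring)))).2
  choose β hβ using hstep
  have halt : ∀ i, β (i + 1) = !β i := by
    intro i
    by_contra hne
    have heq : β (i + 1) = β i := by simpa using hne
    have hP : P (β i) (w i) = P (β i) (w (i + 1 + 1)) := by
      rw [hβ i, ← heq, hβ (i + 1)]
    have hwne : w i ≠ w (i + 1 + 1) := fun hw => h2 <| by
      have := w.injective hw
      linear_combination -this
    rcases (hadj _ _).1 ((h.adj _ _).2 ⟨hwne, _, hP⟩) with hd | hd
    · exact h3 (by linear_combination -hd)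
    · exact h1 (by linear_combination hd)
  have hpar : ∀ n : ℕ, β (n : Fin (2 * q + 3)) = xor (β 0) (decide (n % 2 = 1)) := by
    intro n
    induction n with
    | zero => simp
    | succ n ih =>
      rw [Nat.cast_succ, halt, ih]
      rcases Nat.mod_two_eq_zero_or_one n with hn | hn
      · simp [hn, Nat.add_mod]
      · simp [hn, Nat.add_mod]
  -- Once around the cycle the index returns to `0`, but an odd number of flips has occurred.
  have := hpar (2 * q + 3)
  rw [Fin.natCast_self, show (2 * q + 3) % 2 = 1 by omega] at this
  simp at this

end IsTrianglePartition

end SimpleGraph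

theorem mainTheorem8 {V : Type*} [Fintype V] (G : SimpleGraph V) [G.LocallyFinite]
    (hreg : G.IsRegularOfDegree 4) (hclaw : G.ClawFree) (hstar : G.StarColorable 4) :
    (∃ (n : ℕ) (H : SimpleGraph (Fin n)) (_ : H.LocallyFinite),
      H.IsBipartite ∧ H.IsRegularOfDegree 3 ∧ Nonempty (G ≃g H.lineGraph)) ∧
    G.OddHoleFree := by
  classical
  obtain ⟨n, P, κ, h⟩ := SimpleGraph.exists_isTrianglePartition hreg hclaw hstar
  let hfin : (SimpleGraph.IsTrianglePartition.blockGraph P κ h.side).LocallyFinite :=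
    fun _ => Fintype.ofFinite _
  exact ⟨⟨n, _, hfin, h.isBipartite, h.isRegularOfDegree,
    h.nonempty_iso_lineGraph⟩, h.oddHoleFree⟩
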